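/- **Setting.** Let $\varphi$ be a 3-CNF formula with variables $x_1,\dots,x_n$ and $m$ clauses of exactly three literals. Let $\underline p_1<\overline p_1<\underline p_2<\overline p_2<\dots<\underline p_n<\overline p_n$ be primes with $b_i:=\overline p_i-\underline p_i<\underline p_i$, and let $Q$ be a finite set of further primes, none of which is a $\underline p_i$ or $\overline p_i$. Put $$\alpha_c=\prod_{q\in Q}\Bigl(1-\frac1q\Bigr),\qquad \overline\alpha_v=\prod_{i=1}^n\Bigl(1-\frac1{\overline p_i}\Bigr),\qquad \delta=\frac1{6n\,\overline p_n^{\,6}} .$$ The joint replenishment instance $\Gamma$ has three types of commodities. *Constants*: one commodity for each $p\in\{\underline p_1,\overline p_1,\dots,\underline p_n,\overline p_n\}$ and $q\in Q$, with nominal cycle time $t^*=pq$. *Clauses*: one commodity for each clause of $\varphi$, whose nominal cycle time $t^*$ is the product of the primes of its three literals ($\overline p_i$ for the literal $x_i$, $\underline p_i$ for $\neg x_i$). *Variables*: one commodity $c_i^x$ for each $i$. The joint ordering cost is $K_0=1$ and each demand rate is $2$. Constants and Clauses have holding cost $h_c=\frac{1}{(\delta^2+2\delta)(t^*_c)^2}$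 and ordering cost $K_c=\frac1{\delta^2+2\delta}$, and $$h_{c_i^x}=\alpha_c\,\frac{\underline p_i^2-b_i^2}{\underline p_i(\underline p_i+\frac{b_i}2)\frac{b_i}2},\qquad K_{c_i^x}=h_{c_i^x}\,\underline p_i(\underline p_i+b_i)-\frac{\underline p_i+b_i}{\underline p_i+b_i-1}\,\alpha_c\overline\alpha_v .$$ A solution $S$ assigns a cycle time $t_c>0$ to each commodity $c$, which is then ordered at times $t_c,2t_c,3t_c,\dots$. For a set $A$ of commodities, $UJR_S(A)$ is the long-run average number, per time unit, of times at which at least one commodity of $A$ is ordered. For a set $V$ of Variables commodities let $$TC_V(S)=\sum_{c\in V}\Bigl(\frac{K_c}{t_c}+h_ct_c\Bigr)+K_0\bigl(UJR_S(\text{Constants}\cup V)-UJR_S(\text{Constants})\bigr),$$ and write $TC_{\text{Variables}}(S)$ when $V$ is the set of all Variables commodities. The marginal cost of $c_i^x$ at cycle time $t$, given $S$, is $$\Delta_i(t,S)=TC_{\text{Variables}}(S')-TC_{\text{Variables}\setminus\{c_i^x\}}(S'),$$ where $S'$ is $S$ with the cycle time of $c_i^x$ replaced by $t$. **Lemma.**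 Let $1\le\beta\le1+\delta$, and let $S$ be a solution with $t_c=\beta t_c^*$ for every $c$ in Constants and Clauses, and $t_{c_i^x}\in\{\beta\underline p_i,\beta\overline p_i\}$ for every $i$. Then: 1. For every $i$, $\Delta_i(\beta\underline p_i,S)\le\Delta_i(\beta\overline p_i,S)$. The inequality is strict if $\beta>1$, and also if $t_{c_j^x}=\beta\underline p_j$ for some $j\ne i$. 2. If $\beta\underline S$ and $\beta\overline S$ denote $S$ with the cycle times of all Variables commodities replaced by $t_{c_i^x}=\beta\underline p_i$ for all $i$, and by $t_{c_i^x}=\beta\overline p_i$ for all $i$, respectively, then $$TC_{\text{Variables}}(\beta\underline S)\le TC_{\text{Variables}}(S)\le TC_{\text{Variables}}(\beta\overline S).$$ -/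

import Mathlib

open Filter Topology

noncomputable section

namespace JRP

/-! ### Long-run frequency of joint replenishments -/

/-- The order times `t, 2t, 3t, …` of a commodity with cycle time `t`. -/
def orderTimes (t : ℝ) : Set ℝ := {x | ∃ k : ℕ, 0 < k ∧ x = k * t}

/-- The average number of points of `F` per time unit over an infinite horizon. -/
def rate (F : Set ℝ) : ℝ :=
  limUnder atTop (fun T : ℝ => ((F ∩ Set.Iic T).ncard : ℝ) / T)

theorem orderTimes_inter {s t : ℝ} (hs : 0 < s) (ht : 0 < t) :
    orderTimes s ∩ orderTimes t = ∅ ∨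
      ∃ r : ℝ, 0 < r ∧ orderTimes s ∩ orderTimes t = orderTimes r := by
  classical
  by_cases h : ∃ k : ℕ, 0 < k ∧ ∃ l : ℕ, 0 < l ∧ (k : ℝ) * s = l * t
  · right
    obtain ⟨hk0, l0, hl0, e0⟩ := Nat.find_spec h
    set k0 := Nat.find h with hk0def
    have hk0' : (0 : ℝ) < k0 := by exact_mod_cast hk0
    refine ⟨k0 * s, by positivity, ?_⟩
    ext x
    constructor
    · rintro ⟨⟨k, hk, rfl⟩, ⟨l, hl, e⟩⟩
      have hdm : (k : ℝ) = k0 * (k / k0 : ℕ) + (k % k0 : ℕ) := by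
        exact_mod_cast (Nat.div_add_mod k k0).symm
      have key : ((k % k0 : ℕ) : ℝ) * s = ((l : ℝ) - (k / k0 : ℕ) * l0) * t := by
        have : ((k % k0 : ℕ) : ℝ) * s = k * s - (k / k0 : ℕ) * (k0 * s) := by
          rw [hdm]; ring
        rw [this, e, e0]; ring
      have hz : k % k0 = 0 := by
        by_contra hne
        have hpos : 0 < k % k0 := Nat.pos_of_ne_zero hne
        have hpos' : (0 : ℝ) < (k % k0 : ℕ) := by exact_mod_cast hpos
        have h1 : 0 < (l : ℝ) - (k / k0 : ℕ) * l0 := by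
          have : 0 < ((l : ℝ) - (k / k0 : ℕ) * l0) * t := by rw [← key]; positivity
          exact pos_of_mul_pos_left this ht.le
        have h2 : (k / k0) * l0 < l := by
          have : ((k / k0 : ℕ) : ℝ) * l0 < l := by linarith
          exact_mod_cast this
        have hmin := Nat.find_min' h (m := k % k0)
          ⟨hpos, l - (k / k0) * l0, by omega, by
            rw [key, Nat.cast_sub h2.le]; push_cast; ring⟩
        have := Nat.mod_lt k hk0
        omega
      refine ⟨k / k0, ?_, ?_⟩
      · have := Nat.div_add_mod k k0
        rcases Nat.eq_zero_or_pos (k / k0) with h0 | h0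
        · rw [h0, hz] at this; omega
        · exact h0
      · rw [hz] at hdm
        rw [hdm]; push_cast; ring
    · rintro ⟨d, hd, rfl⟩
      exact ⟨⟨d * k0, by positivity, by push_cast; ring⟩,
        ⟨d * l0, by positivity, by rw [e0]; push_cast; ring⟩⟩
  · left
    ext x
    simp only [Set.mem_inter_iff, Set.mem_empty_iff_false, iff_false]
    rintro ⟨⟨k, hk, rfl⟩, ⟨l, hl, e⟩⟩
    exact h ⟨k, hk, l, hl, e⟩

theorem orderTimes_inter_Iic {t : ℝ} (ht : 0 < t) (T : ℝ) :
    orderTimes t ∩ Set.Iic T =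
      (fun k : ℕ => (k : ℝ) * t) '' (Finset.Icc 1 ⌊t⁻¹ * T⌋₊ : Finset ℕ) := by
  ext x
  simp only [Set.mem_inter_iff, Set.mem_Iic, Set.mem_image, Finset.coe_Icc, Set.mem_Icc]
  constructor
  · rintro ⟨⟨k, hk, rfl⟩, hT⟩
    refine ⟨k, ⟨hk, Nat.le_floor ?_⟩, rfl⟩
    rw [inv_mul_eq_div, le_div_iff₀ ht]; exact hT
  · rintro ⟨k, ⟨hk, hkT⟩, rfl⟩
    refine ⟨⟨k, hk, rfl⟩, ?_⟩
    have := (Nat.le_floor_iff' (by omega)).1 hkT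
    rwa [inv_mul_eq_div, le_div_iff₀ ht] at this

theorem orderTimes_inter_biUnion {t : ℝ} (ht : 0 < t) (L : List ℝ) (hL : ∀ s ∈ L, 0 < s) :
    ∃ L' : List ℝ, (∀ s ∈ L', 0 < s) ∧ L'.length ≤ L.length ∧
      orderTimes t ∩ (⋃ s ∈ L, orderTimes s) = ⋃ s ∈ L', orderTimes s := by
  induction L with
  | nil => exact ⟨[], by simp, by simp, by simp⟩
  | cons s M ihM =>
    obtain ⟨M', h1, h2, h3⟩ := ihM (fun s hs => hL s (by simp [hs]))
    have hsplit : orderTimes t ∩ (⋃ u ∈ s :: M, orderTimes u) =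
        (orderTimes t ∩ orderTimes s) ∪ (orderTimes t ∩ ⋃ u ∈ M, orderTimes u) := by
      rw [← Set.inter_union_distrib_left]; congr 1; ext x; simp
    rcases orderTimes_inter ht (hL s (by simp)) with he | ⟨r, hr, he⟩
    · exact ⟨M', h1, by simp; omega, by rw [hsplit, he, h3]; simp⟩
    · refine ⟨r :: M', ?_, by simpa using h2, ?_⟩
      · intro u hu
        rcases List.mem_cons.1 hu with rfl | hu
        · exact hr
        · exact h1 u hu
      · rw [hsplit, he, h3]; ext x; simp

/-- The long-run frequency of a finite union of order sequences exists, so that the limit in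
`rate` is a genuine one. -/
theorem exists_rate (n : ℕ) : ∀ L : List ℝ, L.length ≤ n → (∀ t ∈ L, 0 < t) →
    (∀ T : ℝ, ((⋃ t ∈ L, orderTimes t) ∩ Set.Iic T).Finite) ∧
      ∃ r : ℝ, Tendsto (fun T : ℝ => (((⋃ t ∈ L, orderTimes t) ∩ Set.Iic T).ncard : ℝ) / T)
        atTop (𝓝 r) := by
  induction n with
  | zero =>
    intro L hlen _
    obtain rfl := List.length_eq_zero_iff.1 (Nat.le_zero.1 hlen)
    exact ⟨by simp, 0, by simp⟩
  | succ n ih =>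
    intro L hlen hL
    rcases L with _ | ⟨t, L⟩
    · exact ⟨by simp, 0, by simp⟩
    have ht : 0 < t := hL t (by simp)
    have hL' : ∀ s ∈ L, 0 < s := fun s hs => hL s (by simp [hs])
    have hlen' : L.length ≤ n := by simpa using hlen
    obtain ⟨fU, rU, hU⟩ := ih L hlen' hL'
    obtain ⟨M, hM, hMlen, hMe⟩ := orderTimes_inter_biUnion ht L hL'
    obtain ⟨fI, rI, hI⟩ := ih M (hMlen.trans hlen') hM
    have hsplit : (⋃ u ∈ t :: L, orderTimes u) = orderTimes t ∪ ⋃ u ∈ L, orderTimes u := by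
      ext x; simp
    have ft : ∀ T, (orderTimes t ∩ Set.Iic T).Finite := fun T => by
      rw [orderTimes_inter_Iic ht]; exact (Finset.finite_toSet _).image _
    have ct : ∀ T, (orderTimes t ∩ Set.Iic T).ncard = ⌊t⁻¹ * T⌋₊ := fun T => by
      rw [orderTimes_inter_Iic ht, Set.ncard_image_of_injective, Set.ncard_coe_finset]
      · simp
      · intro a b hab
        exact_mod_cast mul_right_cancel₀ ht.ne' hab
    refine ⟨fun T => ?_, t⁻¹ + rU - rI, ?_⟩
    · rw [hsplit, Set.union_inter_distrib_right]; exact (ft T).union (fU T)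
    · have h1 := tendsto_nat_floor_mul_div_atTop (R := ℝ) (a := t⁻¹) (by positivity)
      refine ((h1.add hU).sub hI).congr fun T => ?_
      rw [hsplit, Set.union_inter_distrib_right]
      have h2 := Set.ncard_union_add_ncard_inter (orderTimes t ∩ Set.Iic T)
        ((⋃ u ∈ L, orderTimes u) ∩ Set.Iic T) (ft T) (fU T)
      rw [← Set.inter_inter_distrib_right, hMe, ct] at h2
      have h3 : (((orderTimes t ∩ Set.Iic T ∪ (⋃ u ∈ L, orderTimes u) ∩ Set.Iic T).ncard : ℕ) : ℝ)
          + (((⋃ u ∈ M, orderTimes u) ∩ Set.Iic T).ncard : ℕ) =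
          (⌊t⁻¹ * T⌋₊ : ℕ) + (((⋃ u ∈ L, orderTimes u) ∩ Set.Iic T).ncard : ℕ) := by
        exact_mod_cast h2
      rw [← add_div, ← sub_div]
      congr 1
      linarith

/-! ### The instance built from a 3SAT formula -/

/-- A formula in conjunctive normal form with `n` variables and `m` clauses of exactly three
literals; the literal `(i, true)` is `xᵢ` and `(i, false)` is its negation. -/
abbrev ThreeCNF (n m : ℕ) := Fin m → Fin 3 → Fin n × Bool

/-- The primes used in the reduction: a pair `lo i < hi i` of primes for each of the `n` variables,
the pairs being in ascending order and pairwise disjoint, and a finite set of further primes. -/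
structure Primes (n : ℕ) where
  lo : Fin n → ℕ
  hi : Fin n → ℕ
  others : Finset ℕ
  lo_prime : ∀ i, (lo i).Prime
  hi_prime : ∀ i, (hi i).Prime
  lo_lt_hi : ∀ i, lo i < hi i
  hi_lt_lo : ∀ i j, i < j → hi i < lo j
  others_prime : ∀ q ∈ others, q.Prime
  lo_notMem : ∀ i, lo i ∉ others
  hi_notMem : ∀ i, hi i ∉ others
  /-- The gap `hi i - lo i` is smaller than `lo i` (so that holding costs are positive). -/
  hi_lt_two_lo : ∀ i, hi i < 2 * lo i

/-- The commodities of the instance: a constant for each product of a variable prime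
(`true` for `hi i`, `false` for `lo i`) with one of the further primes, one commodity
for each variable, and one for each clause. -/
inductive Commodity (n m : ℕ) (Q : Finset ℕ) where
  | constant (i : Fin n) (v : Bool) (q : Q) : Commodity n m Q
  | variable (i : Fin n) : Commodity n m Q
  | clause (k : Fin m) : Commodity n m Q

namespace Primes

variable {n m : ℕ} (P : Primes n)

/-- The prime of the literal `(i, v)`. -/
def prime (i : Fin n) (v : Bool) : ℕ := if v then P.hi i else P.lo i

/-- The gap `bᵢ`. -/
def gap (i : Fin n) : ℝ := (P.hi i : ℝ) - P.lo i

/-- `α_c = ∏ (1 - 1/q)` over the further primes `q`. -/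
def alphaC : ℝ := ∏ q ∈ P.others, (1 - 1 / (q : ℝ))

/-- `ᾱ_v = ∏ (1 - 1/hi i)` over the variables. -/
def alphaV : ℝ := ∏ i, (1 - 1 / (P.hi i : ℝ))

/-- `δ = 1 / (6 n p⁶)`, where `p` is the largest of the primes `hi i`. -/
def delta : ℝ := 1 / (6 * n * ((Finset.univ.sup P.hi : ℕ) : ℝ) ^ 6)

/-- The nominal integer cycle time `t*` of a constant. -/
def constantTime (i : Fin n) (v : Bool) (q : P.others) : ℝ := (P.prime i v : ℝ) * (q : ℕ)

/-- The nominal integer cycle time `t*` of a clause, the product of the primes of its literals. -/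
def clauseTime (φ : ThreeCNF n m) (k : Fin m) : ℝ :=
  ∏ l, (P.prime (φ k l).1 (φ k l).2 : ℝ)

/-- Holding cost rates `h_c`. -/
def holdingCost (φ : ThreeCNF n m) : Commodity n m P.others → ℝ
  | .constant i v q => 1 / ((P.delta ^ 2 + 2 * P.delta) * P.constantTime i v q ^ 2)
  | .variable i => P.alphaC * (((P.lo i : ℝ) ^ 2 - P.gap i ^ 2) /
      (P.lo i * (P.lo i + P.gap i / 2) * (P.gap i / 2)))
  | .clause k => 1 / ((P.delta ^ 2 + 2 * P.delta) * P.clauseTime φ k ^ 2)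

/-- Individual ordering costs `K_c`. -/
def orderingCost (φ : ThreeCNF n m) : Commodity n m P.others → ℝ
  | .constant _ _ _ => 1 / (P.delta ^ 2 + 2 * P.delta)
  | .variable i => P.holdingCost φ (.variable i) * P.lo i * (P.lo i + P.gap i) -
      (P.lo i + P.gap i) / (P.lo i + P.gap i - 1) * P.alphaC * P.alphaV
  | .clause _ => 1 / (P.delta ^ 2 + 2 * P.delta)

/-- The joint ordering cost `K₀`. -/
def jointCost : ℝ := 1

/-- The demand rate `λ_c`, common to all commodities. -/
def demand : ℝ := 2

/-- A solution assigns a cycle time to every commodity. -/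
abbrev Solution (P : Primes n) (m : ℕ) := Commodity n m P.others → ℝ

/-- The standalone average cost `K_c / t + λ_c h_c t / 2` of commodity `c` at cycle time `t`. -/
def standaloneCost (φ : ThreeCNF n m) (c : Commodity n m P.others) (t : ℝ) : ℝ :=
  P.orderingCost φ c / t + demand * P.holdingCost φ c * t / 2

end Primes

section Cost

variable {n m : ℕ} {P : Primes n}

/-- `UJR`: the average number of joint replenishments per time unit induced by the commodities
in `A` under the solution `S`. -/
def jointRate (S : P.Solution m) (A : Set (Commodity n m P.others)) : ℝ :=
  rate (⋃ c ∈ A, orderTimes (S c))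

/-- The set of constants. -/
def constants (P : Primes n) (m : ℕ) : Set (Commodity n m P.others) :=
  {c | ∃ i v q, c = .constant i v q}

/-- The cost of the variable commodities with index in `V`: their standalone costs, plus the
cost of the joint replenishments that they add to those of the constants. -/
def variablesCostOn (φ : ThreeCNF n m) (S : P.Solution m) (V : Finset (Fin n)) : ℝ :=
  ∑ i ∈ V, P.standaloneCost φ (.variable i) (S (.variable i)) +
    Primes.jointCost * (jointRate S (constants P m ∪ {c | ∃ i ∈ V, c = .variable i}) -
      jointRate S (constants P m))

/-- `TC_Variables(S)`. -/
def variablesCost (φ : ThreeCNF n m) (S : P.Solution m) : ℝ :=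
  variablesCostOn φ S Finset.univ

/-- `S` with the cycle time of variable commodity `i` set to `t`. -/
def setVariable (S : P.Solution m) (i : Fin n) (t : ℝ) : P.Solution m
  | .variable j => if j = i then t else S (.variable j)
  | c => S c

/-- `S` with the cycle times of all variable commodities set to those given by `t`. -/
def setVariables (S : P.Solution m) (t : Fin n → ℝ) : P.Solution m
  | .variable j => t j
  | c => S c

/-- The marginal cost added to `TC_Variables` by variable commodity `i` at cycle time `t`, when
all other commodities follow the solution `S`. -/
def marginalCost (φ : ThreeCNF n m) (i : Fin n) (t : ℝ) (S : P.Solution m) : ℝ :=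
  variablesCost φ (setVariable S i t) -
    variablesCostOn φ (setVariable S i t) (Finset.univ.erase i)

/-- `S` has the form of an optimal solution with seed `β`: all constants and clauses are ordered at
`β` times their nominal cycle times, where `1 ≤ β ≤ 1 + δ`, and each variable commodity `i` at
`β * lo i` or `β * hi i`. -/
structure HasSeed (φ : ThreeCNF n m) (S : P.Solution m) (β : ℝ) : Prop where
  one_le : 1 ≤ β
  le_one_add : β ≤ 1 + P.delta
  constant_eq : ∀ i v q, S (.constant i v q) = β * P.constantTime i v q
  clause_eq : ∀ k, S (.clause k) = β * P.clauseTime φ k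
  variable_mem : ∀ i, S (.variable i) = β * P.lo i ∨ S (.variable i) = β * P.hi i

end Cost

end JRP

end

/-!
Dividing every cycle time by `β` turns the order times into integers. Let the variable commodities
be ordered at `β pⱼ`, where `pⱼ` is one of the primes `lo j`, `hi j`. A variable commodity of a set
`V` adds a joint replenishment at `β k` exactly when some `pⱼ`, `j ∈ V`, divides `k` and no further
prime `q` does: if `pⱼ ∣ k`, then `k` is an order time of a constant if and only if some `q`
divides `k`. By sieving, the integers with no divisor in a finite set of primes have density
`∏ (1 - 1 / p)` (`hasDensity_sifted`), so the added rate is `α_c (1 - ∏ j ∈ V, (1 - 1 / pⱼ)) / β`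
(`Selects.jointRate_sub`).

The marginal cost of commodity `i` at cycle time `β p` is therefore `(K + A) / (β p) + h β p` with
`A = α_c ∏ j ≠ i, (1 - 1 / pⱼ)`, while `K = h p (p + b) - M`, where `M` is the value of `A` at
`pⱼ = hi j`. Hence the marginal cost at `hi i` exceeds the one at `lo i` by
`b (h (β - 1 / β) + (M - A) / (β p (p + b)))`, in which both terms are nonnegative; the first is
positive if `β > 1`, the second if some `pⱼ`, `j ≠ i`, equals `lo j`
(`Selects.marginalCost_le`, `Selects.marginalCost_lt`). The bounds on the total cost follow by
changing the cycle times of the variable commodities one at a time (`Selects.monotone_selectedCost`).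
-/

open Filter Topology

namespace JRP

/-! ### Densities of sets of natural numbers -/

/-- `A` has natural density `d`: the number of elements of `A` up to the real number `T` is
asymptotic to `d T`. Real cutoffs make the density compatible with dilations. -/
def HasDensity (A : Set ℕ) (d : ℝ) : Prop :=
  Tendsto (fun T : ℝ => ((A ∩ {k : ℕ | (k : ℝ) ≤ T}).ncard : ℝ) / T) atTop (𝓝 d)

theorem finite_inter_cast_le (A : Set ℕ) (T : ℝ) : (A ∩ {k : ℕ | (k : ℝ) ≤ T}).Finite :=
  (Set.finite_Iic ⌊T⌋₊).subset fun _ hk => Nat.le_floor hk.2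

theorem HasDensity.union {A B : Set ℕ} {a b : ℝ} (hA : HasDensity A a) (hB : HasDensity B b)
    (hAB : Disjoint A B) : HasDensity (A ∪ B) (a + b) := by
  refine (Tendsto.add hA hB).congr fun T => ?_
  rw [Set.union_inter_distrib_right, Set.ncard_union_eq
    (hAB.mono Set.inter_subset_left Set.inter_subset_left) (finite_inter_cast_le A T)
    (finite_inter_cast_le B T)]
  push_cast
  ring

theorem HasDensity.diff {A B : Set ℕ} {a b : ℝ} (hB : HasDensity B b) (hA : HasDensity A a)
    (hAB : A ⊆ B) : HasDensity (B \ A) (b - a) := by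
  refine (Tendsto.sub hB hA).congr fun T => ?_
  have h := Set.ncard_sdiff_add_ncard_of_subset
    (Set.inter_subset_inter_left {k : ℕ | (k : ℝ) ≤ T} hAB) (finite_inter_cast_le B T)
  have hset : (B ∩ {k : ℕ | (k : ℝ) ≤ T}) \ (A ∩ {k : ℕ | (k : ℝ) ≤ T}) =
      (B \ A) ∩ {k : ℕ | (k : ℝ) ≤ T} := by
    ext k; simp only [Set.mem_sdiff, Set.mem_inter_iff]; tauto
  rw [hset] at h
  rw [← h]
  push_cast
  ring

/-- Dilating `A` by `β` divides the density by `β`, stated for the counting function of `A`. -/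
theorem HasDensity.tendsto_div {A : Set ℕ} {d β : ℝ} (hA : HasDensity A d) (hβ : 0 < β) :
    Tendsto (fun T : ℝ => ((A ∩ {k : ℕ | (k : ℝ) ≤ T / β}).ncard : ℝ) / T) atTop
      (𝓝 (d / β)) := by
  have h := (Tendsto.comp hA (tendsto_id.atTop_div_const hβ)).div_const β
  refine h.congr fun T => ?_
  simp only [Function.comp_apply, id]
  rw [div_div, div_mul_cancel₀ T hβ.ne']

theorem HasDensity.image_mul {A : Set ℕ} {d : ℝ} (hA : HasDensity A d) {p : ℕ} (hp : 0 < p) :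
    HasDensity ((fun k => p * k) '' A) (d / p) := by
  have hp' : (0 : ℝ) < p := by exact_mod_cast hp
  refine (hA.tendsto_div hp').congr fun T => ?_
  have hset : (fun k => p * k) '' A ∩ {k : ℕ | (k : ℝ) ≤ T} =
      (fun k => p * k) '' (A ∩ {k : ℕ | (k : ℝ) ≤ T / p}) := by
    rw [← Set.image_inter_preimage]
    congr 2
    ext k
    simp [le_div_iff₀ hp', mul_comm]
  rw [hset, Set.ncard_image_of_injective _ fun a b hab => Nat.eq_of_mul_eq_mul_left hp hab]

theorem HasDensity.rate_image {A : Set ℕ} {d β : ℝ} (hA : HasDensity A d) (hβ : 0 < β) :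
    rate ((fun k : ℕ => (k : ℝ) * β) '' A) = d / β := by
  refine Tendsto.limUnder_eq ((hA.tendsto_div hβ).congr fun T => ?_)
  have hset : (fun k : ℕ => (k : ℝ) * β) '' A ∩ Set.Iic T =
      (fun k : ℕ => (k : ℝ) * β) '' (A ∩ {k : ℕ | (k : ℝ) ≤ T / β}) := by
    rw [← Set.image_inter_preimage]
    congr 2
    ext k
    simp [le_div_iff₀ hβ]
  rw [hset, Set.ncard_image_of_injective]
  intro a b hab
  exact_mod_cast mul_right_cancel₀ hβ.ne' hab

/-- The positive integers that no element of `F` divides. -/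
def sifted (F : Finset ℕ) : Set ℕ := {k | 0 < k ∧ ∀ p ∈ F, ¬ p ∣ k}

theorem sifted_anti {F G : Finset ℕ} (h : F ⊆ G) : sifted G ⊆ sifted F :=
  fun _ hk => ⟨hk.1, fun p hp => hk.2 p (h hp)⟩

/-- The sieve of Eratosthenes: the elements of `sifted F` that a further prime `p` removes are the
multiples by `p` of the elements of `sifted F`. -/
theorem hasDensity_sifted (F : Finset ℕ) (hF : ∀ p ∈ F, p.Prime) :
    HasDensity (sifted F) (∏ p ∈ F, (1 - 1 / (p : ℝ))) := by
  induction F using Finset.induction_on with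
  | empty =>
    have h := tendsto_nat_floor_mul_div_atTop (R := ℝ) (a := 1) zero_le_one
    rw [Finset.prod_empty]
    refine h.congr fun T => ?_
    have hset : sifted ∅ ∩ {k : ℕ | (k : ℝ) ≤ T} = (Finset.Icc 1 ⌊T⌋₊ : Finset ℕ) := by
      ext k
      simp only [sifted, Set.mem_inter_iff, Set.mem_ofPred_eq, Finset.coe_Icc, Set.mem_Icc]
      constructor
      · rintro ⟨⟨hk, -⟩, hT⟩
        exact ⟨hk, Nat.le_floor hT⟩
      · rintro ⟨hk, hT⟩
        exact ⟨⟨hk, by simp⟩, (Nat.le_floor_iff' (by omega)).1 hT⟩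
    rw [hset, Set.ncard_coe_finset]
    simp
  | insert p F hpF ih =>
    have hp : p.Prime := hF p (by simp)
    have hF' : ∀ q ∈ F, q.Prime := fun q hq => hF q (by simp [hq])
    have hd := ih hF'
    have hsub : (fun k => p * k) '' sifted F ⊆ sifted F := by
      rintro _ ⟨k, ⟨hk, hkF⟩, rfl⟩
      refine ⟨Nat.mul_pos hp.pos hk, fun q hq hqk => ?_⟩
      rcases (hF' q hq).dvd_mul.1 hqk with h | h
      · exact hpF ((Nat.prime_dvd_prime_iff_eq (hF' q hq) hp).1 h ▸ hq)
      · exact hkF q hq h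
    have hset : sifted (insert p F) = sifted F \ (fun k => p * k) '' sifted F := by
      ext k
      constructor
      · rintro ⟨hk, hkF⟩
        refine ⟨⟨hk, fun q hq => hkF q (by simp [hq])⟩, ?_⟩
        rintro ⟨l, -, rfl⟩
        exact hkF p (by simp) ⟨l, rfl⟩
      · rintro ⟨⟨hk, hkF⟩, hn⟩
        refine ⟨hk, fun q hq => ?_⟩
        rcases Finset.mem_insert.1 hq with rfl | hq
        · rintro ⟨l, rfl⟩
          exact hn ⟨l, ⟨Nat.pos_of_mul_pos_left hk,
            fun r hr h => hkF r hr (h.mul_left q)⟩, rfl⟩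
        · exact hkF q hq
    rw [hset, Finset.prod_insert hpF]
    convert hd.diff (hd.image_mul hp.pos) hsub using 1
    ring

/-- The positive integers divisible by some element of `F` but by no element of `G`. -/
def hitOutside (F G : Finset ℕ) : Set ℕ :=
  {k | 0 < k ∧ (∃ p ∈ F, p ∣ k) ∧ ∀ q ∈ G, ¬ q ∣ k}

theorem hasDensity_hitOutside {F G : Finset ℕ} (hF : ∀ p ∈ F, p.Prime) (hG : ∀ q ∈ G, q.Prime)
    (hFG : Disjoint F G) :
    HasDensity (hitOutside F G)
      ((∏ q ∈ G, (1 - 1 / (q : ℝ))) * (1 - ∏ p ∈ F, (1 - 1 / (p : ℝ)))) := by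
  have hset : hitOutside F G = sifted G \ sifted (F ∪ G) := by
    ext k
    simp only [hitOutside, sifted, Set.mem_ofPred_eq, Set.mem_sdiff, Finset.mem_union]
    constructor
    · rintro ⟨hk, ⟨p, hp, hpk⟩, hkG⟩
      exact ⟨⟨hk, hkG⟩, fun h => h.2 p (Or.inl hp) hpk⟩
    · rintro ⟨⟨hk, hkG⟩, h⟩
      refine ⟨hk, ?_, hkG⟩
      by_contra! hn
      exact h ⟨hk, fun p hp => hp.elim (hn p) (hkG p)⟩
  have hFG' : ∀ p ∈ F ∪ G, p.Prime := fun p hp => (Finset.mem_union.1 hp).elim (hF p) (hG p)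
  rw [hset]
  convert (hasDensity_sifted G hG).diff (hasDensity_sifted _ hFG')
    (sifted_anti Finset.subset_union_right) using 1
  rw [Finset.prod_union hFG]
  ring

/-- The positive integers divisible both by some element of `F` and by some element of `G`. -/
def hitBoth (F G : Finset ℕ) : Set ℕ :=
  {k | 0 < k ∧ (∃ p ∈ F, p ∣ k) ∧ ∃ q ∈ G, q ∣ k}

theorem exists_hasDensity_hitBoth {F G : Finset ℕ} (hF : ∀ p ∈ F, p.Prime)
    (hG : ∀ q ∈ G, q.Prime) (hFG : Disjoint F G) : ∃ d, HasDensity (hitBoth F G) d := by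
  have hset : hitBoth F G = hitOutside F ∅ \ hitOutside F G := by
    ext k
    simp only [hitBoth, hitOutside, Set.mem_ofPred_eq, Set.mem_sdiff, Finset.notMem_empty,
      false_imp_iff, implies_true, and_true]
    constructor
    · rintro ⟨hk, hkF, q, hq, hqk⟩
      exact ⟨⟨hk, hkF⟩, fun h => h.2.2 q hq hqk⟩
    · rintro ⟨⟨hk, hkF⟩, h⟩
      refine ⟨hk, hkF, ?_⟩
      by_contra! hn
      exact h ⟨hk, hkF, hn⟩
  rw [hset]
  exact ⟨_, (hasDensity_hitOutside hF (by simp) (by simp)).diff (hasDensity_hitOutside hF hG hFG)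
    fun k hk => ⟨hk.1, hk.2.1, by simp⟩⟩

theorem orderTimes_mul_natCast (β : ℝ) {p : ℕ} (hp : 0 < p) :
    orderTimes (β * p) = (fun k : ℕ => (k : ℝ) * β) '' {k | 0 < k ∧ p ∣ k} := by
  ext x
  constructor
  · rintro ⟨k, hk, rfl⟩
    exact ⟨p * k, ⟨by positivity, p.dvd_mul_right k⟩, by push_cast; ring⟩
  · rintro ⟨_, ⟨hk, l, rfl⟩, rfl⟩
    exact ⟨l, Nat.pos_of_mul_pos_left hk, by push_cast; ring⟩

/-! ### The primes of the instance -/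

namespace Primes

variable {n : ℕ} (P : Primes n)

theorem prime_prime (i : Fin n) (v : Bool) : (P.prime i v).Prime := by
  cases v
  · exact P.lo_prime i
  · exact P.hi_prime i

theorem prime_notMem (i : Fin n) (v : Bool) : P.prime i v ∉ P.others := by
  cases v
  · exact P.lo_notMem i
  · exact P.hi_notMem i

theorem prime_le_hi (i : Fin n) (v : Bool) : P.prime i v ≤ P.hi i := by
  cases v
  · exact (P.lo_lt_hi i).le
  · exact le_rfl

theorem lo_le_prime (i : Fin n) (v : Bool) : P.lo i ≤ P.prime i v := by
  cases v
  · exact le_rfl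
  · exact (P.lo_lt_hi i).le

theorem prime_injective (v : Fin n → Bool) : Function.Injective fun i => P.prime i (v i) := by
  have h : StrictMono fun i => P.prime i (v i) := fun i j hij =>
    ((P.prime_le_hi i _).trans_lt (P.hi_lt_lo i j hij)).trans_le (P.lo_le_prime j _)
  exact h.injective

/-- The density of the integers that are not divisible by the prime of the literal `(i, v)`. -/
noncomputable def avoid (i : Fin n) (v : Bool) : ℝ := 1 - 1 / (P.prime i v : ℝ)

theorem avoid_pos (i : Fin n) (v : Bool) : 0 < P.avoid i v := by
  have h : (1 : ℝ) < P.prime i v := by exact_mod_cast (P.prime_prime i v).one_lt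
  rw [avoid, sub_pos, div_lt_one (by linarith)]
  exact h

theorem avoid_false_lt (i : Fin n) : P.avoid i false < P.avoid i true := by
  have h0 : (0 : ℝ) < P.lo i := by exact_mod_cast (P.lo_prime i).pos
  have h : (P.lo i : ℝ) < P.hi i := by exact_mod_cast P.lo_lt_hi i
  have := one_div_lt_one_div_of_lt h0 h
  simp only [avoid, prime, if_true, Bool.false_eq_true, if_false]
  linarith

theorem avoid_le (i : Fin n) (v : Bool) : P.avoid i v ≤ P.avoid i true := by
  cases v
  · exact (P.avoid_false_lt i).le
  · exact le_rfl

theorem alphaC_pos : 0 < P.alphaC := by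
  refine Finset.prod_pos fun q hq => ?_
  have h : (1 : ℝ) < q := by exact_mod_cast (P.others_prime q hq).one_lt
  rw [sub_pos, div_lt_one (by linarith)]
  exact h

theorem gap_pos (i : Fin n) : 0 < P.gap i := by
  have h : (P.lo i : ℝ) < P.hi i := by exact_mod_cast P.lo_lt_hi i
  exact sub_pos.2 h

theorem holdingCost_variable_pos {m : ℕ} (φ : ThreeCNF n m) (i : Fin n) :
    0 < P.holdingCost φ (.variable i) := by
  have h0 : (0 : ℝ) < P.lo i := by exact_mod_cast (P.lo_prime i).pos
  have hb := P.gap_pos i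
  have hlt : P.gap i < P.lo i := by
    have h : (P.hi i : ℝ) < 2 * P.lo i := by exact_mod_cast P.hi_lt_two_lo i
    rw [gap]; linarith
  have hsq : 0 < (P.lo i : ℝ) ^ 2 - P.gap i ^ 2 := by nlinarith
  have hα := P.alphaC_pos
  rw [holdingCost]
  positivity

/-- The term subtracted in the ordering cost of the variable commodity `i` is `α_c` times the
density of the integers divisible by none of the primes `hi j` with `j ≠ i`. -/
theorem orderingCost_variable {m : ℕ} (φ : ThreeCNF n m) (i : Fin n) :
    P.orderingCost φ (.variable i) = P.holdingCost φ (.variable i) * P.lo i * P.hi i -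
      P.alphaC * ∏ j ∈ Finset.univ.erase i, P.avoid j true := by
  have h1 : (1 : ℝ) < P.hi i := by exact_mod_cast (P.hi_prime i).one_lt
  have hgap : (P.lo i : ℝ) + P.gap i = P.hi i := by rw [gap]; ring
  have hV : P.alphaV = P.avoid i true * ∏ j ∈ Finset.univ.erase i, P.avoid j true :=
    (Finset.mul_prod_erase _ (fun j => P.avoid j true) (Finset.mem_univ i)).symm
  have hi : P.avoid i true = ((P.hi i : ℝ) - 1) / P.hi i := by
    rw [avoid, prime, if_pos rfl]
    field_simp
  have h2 : (P.hi i : ℝ) - 1 ≠ 0 := by linarith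
  rw [orderingCost, hgap, hV, hi]
  field_simp

/-- The primes of the variables. -/
def variablePrimes : Finset ℕ := Finset.univ.image fun x : Fin n × Bool => P.prime x.1 x.2

theorem prime_mem_variablePrimes (i : Fin n) (v : Bool) : P.prime i v ∈ P.variablePrimes :=
  Finset.mem_image_of_mem (fun x : Fin n × Bool => P.prime x.1 x.2) (Finset.mem_univ (i, v))

theorem prime_of_mem_variablePrimes {p : ℕ} (hp : p ∈ P.variablePrimes) : p.Prime := by
  obtain ⟨x, -, rfl⟩ := Finset.mem_image.1 hp
  exact P.prime_prime _ _

theorem disjoint_variablePrimes_others : Disjoint P.variablePrimes P.others := by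
  rw [Finset.disjoint_left]
  intro p hp
  obtain ⟨x, -, rfl⟩ := Finset.mem_image.1 hp
  exact P.prime_notMem _ _

end Primes

/-! ### Joint replenishments of a solution that selects a prime for every variable -/

section Selection

variable {n m : ℕ} {P : Primes n} {S : P.Solution m} {β : ℝ} {v : Fin n → Bool}

/-- In the solution `S` the constants are ordered at `β` times their nominal cycle times, and each
variable commodity `i` at `β` times the prime of the literal `(i, v i)`. -/
structure Selects (S : P.Solution m) (β : ℝ) (v : Fin n → Bool) : Prop where
  constant_eq : ∀ i v q, S (.constant i v q) = β * P.constantTime i v q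
  variable_eq : ∀ i, S (.variable i) = β * P.prime i (v i)

theorem HasSeed.exists_selects {φ : ThreeCNF n m} (h : HasSeed φ S β) : ∃ v, Selects S β v := by
  have hv : ∀ i, ∃ b, S (.variable i) = β * P.prime i b := fun i =>
    (h.variable_mem i).elim (fun e => ⟨false, e⟩) (fun e => ⟨true, e⟩)
  choose v hv using hv
  exact ⟨v, h.constant_eq, hv⟩

theorem Selects.setVariable (h : Selects S β v) (i : Fin n) (b : Bool) :
    Selects (setVariable S i (β * P.prime i b)) β (Function.update v i b) := by
  refine ⟨h.constant_eq, fun j => ?_⟩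
  by_cases hj : j = i
  · subst hj
    simp [JRP.setVariable]
  · simp [JRP.setVariable, hj, h.variable_eq]

theorem Selects.setVariables (h : Selects S β v) (w : Fin n → Bool) :
    Selects (setVariables S fun i => β * P.prime i (w i)) β w :=
  ⟨h.constant_eq, fun _ => rfl⟩

theorem Selects.iUnion_constants (h : Selects S β v) :
    ⋃ c ∈ constants P m, orderTimes (S c) =
      (fun k : ℕ => (k : ℝ) * β) '' hitBoth P.variablePrimes P.others := by
  have hS : ∀ i b (q : P.others), orderTimes (S (.constant i b q)) =
      (fun k : ℕ => (k : ℝ) * β) '' {k | 0 < k ∧ P.prime i b * q ∣ k} := fun i b q => by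
    rw [h.constant_eq, ← orderTimes_mul_natCast β
      (Nat.mul_pos (P.prime_prime i b).pos (P.others_prime q q.2).pos), Nat.cast_mul]
    rfl
  ext x
  simp only [Set.mem_iUnion, exists_prop]
  constructor
  · rintro ⟨_, ⟨i, b, q, rfl⟩, hx⟩
    rw [hS] at hx
    obtain ⟨k, ⟨hk, hd⟩, rfl⟩ := hx
    exact ⟨k, ⟨hk, ⟨_, P.prime_mem_variablePrimes i b, dvd_of_mul_right_dvd hd⟩,
      q, q.2, dvd_of_mul_left_dvd hd⟩, rfl⟩
  · rintro ⟨k, ⟨hk, ⟨p, hp, hpk⟩, q, hq, hqk⟩, rfl⟩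
    obtain ⟨⟨i, b⟩, -, rfl⟩ := Finset.mem_image.1 hp
    refine ⟨_, ⟨i, b, ⟨q, hq⟩, rfl⟩, ?_⟩
    rw [hS]
    refine ⟨k, ⟨hk, Nat.Coprime.mul_dvd_of_dvd_of_dvd ?_ hpk hqk⟩, rfl⟩
    refine (Nat.coprime_primes (P.prime_prime i b) (P.others_prime q hq)).2 fun e => ?_
    exact P.prime_notMem i b (e ▸ hq)

/-- The constants and the variable commodities of `V` jointly: of the order times of the latter,
only those free of the further primes are not already order times of constants. -/
theorem Selects.iUnion_constants_union (h : Selects S β v) (V : Finset (Fin n)) :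
    ⋃ c ∈ constants P m ∪ {c | ∃ i ∈ V, c = .variable i}, orderTimes (S c) =
      (fun k : ℕ => (k : ℝ) * β) '' (hitBoth P.variablePrimes P.others ∪
        hitOutside (V.image fun i => P.prime i (v i)) P.others) := by
  have hS : ∀ i, orderTimes (S (.variable i)) =
      (fun k : ℕ => (k : ℝ) * β) '' {k | 0 < k ∧ P.prime i (v i) ∣ k} := fun i => by
    rw [h.variable_eq, orderTimes_mul_natCast β (P.prime_prime i (v i)).pos]
  rw [Set.biUnion_union, h.iUnion_constants, Set.image_union]
  ext x
  simp only [Set.mem_union, Set.mem_iUnion, exists_prop]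
  constructor
  · rintro (hx | ⟨_, ⟨i, hi, rfl⟩, hx⟩)
    · exact Or.inl hx
    · rw [hS] at hx
      obtain ⟨k, ⟨hk, hd⟩, rfl⟩ := hx
      by_cases hq : ∃ q ∈ P.others, q ∣ k
      · exact Or.inl ⟨k, ⟨hk, ⟨_, P.prime_mem_variablePrimes i _, hd⟩, hq⟩, rfl⟩
      · push Not at hq
        exact Or.inr ⟨k, ⟨hk, ⟨_, Finset.mem_image_of_mem _ hi, hd⟩, hq⟩, rfl⟩
  · rintro (hx | ⟨k, ⟨hk, ⟨p, hp, hd⟩, -⟩, rfl⟩)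
    · exact Or.inl hx
    · obtain ⟨i, hi, rfl⟩ := Finset.mem_image.1 hp
      refine Or.inr ⟨_, ⟨i, hi, rfl⟩, ?_⟩
      rw [hS]
      exact ⟨k, ⟨hk, hd⟩, rfl⟩

theorem Selects.jointRate_sub (h : Selects S β v) (hβ : 0 < β) (V : Finset (Fin n)) :
    jointRate S (constants P m ∪ {c | ∃ i ∈ V, c = .variable i}) - jointRate S (constants P m) =
      P.alphaC * (1 - ∏ i ∈ V, P.avoid i (v i)) / β := by
  obtain ⟨d, hd⟩ := exists_hasDensity_hitBoth (fun p hp => P.prime_of_mem_variablePrimes hp)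
    P.others_prime P.disjoint_variablePrimes_others
  have hsub : (V.image fun i => P.prime i (v i)) ⊆ P.variablePrimes := by
    intro p hp
    obtain ⟨i, -, rfl⟩ := Finset.mem_image.1 hp
    exact P.prime_mem_variablePrimes i _
  have hV := hasDensity_hitOutside (fun p hp => P.prime_of_mem_variablePrimes (hsub hp))
    P.others_prime (P.disjoint_variablePrimes_others.mono_left hsub)
  have hdisj : Disjoint (hitBoth P.variablePrimes P.others)
      (hitOutside (V.image fun i => P.prime i (v i)) P.others) := by
    rw [Set.disjoint_left]
    rintro k ⟨-, -, q, hq, hqk⟩ h'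
    exact h'.2.2 q hq hqk
  rw [jointRate, jointRate, h.iUnion_constants, h.iUnion_constants_union, hd.rate_image hβ,
    (hd.union hV hdisj).rate_image hβ, Finset.prod_image (P.prime_injective v).injOn]
  simp only [Primes.alphaC, Primes.avoid]
  ring

/-! ### Marginal and total costs -/

theorem Selects.variablesCostOn_eq (h : Selects S β v) (hβ : 0 < β) (φ : ThreeCNF n m)
    (V : Finset (Fin n)) :
    variablesCostOn φ S V =
      ∑ i ∈ V, P.standaloneCost φ (.variable i) (β * P.prime i (v i)) +
        P.alphaC * (1 - ∏ i ∈ V, P.avoid i (v i)) / β := by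
  rw [variablesCostOn, h.jointRate_sub hβ, Primes.jointCost, one_mul]
  simp only [h.variable_eq]

theorem Selects.marginalCost_eq (h : Selects S β v) (hβ : 0 < β) (φ : ThreeCNF n m)
    (i : Fin n) (b : Bool) :
    marginalCost φ i (β * P.prime i b) S =
      P.standaloneCost φ (.variable i) (β * P.prime i b) +
        P.alphaC * (∏ j ∈ Finset.univ.erase i, P.avoid j (v j)) / (β * P.prime i b) := by
  have h' := h.setVariable i b
  have hp : (P.prime i b : ℝ) ≠ 0 := by exact_mod_cast (P.prime_prime i b).ne_zero
  have hprod : ∏ j ∈ Finset.univ.erase i, P.avoid j (Function.update v i b j) =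
      ∏ j ∈ Finset.univ.erase i, P.avoid j (v j) :=
    Finset.prod_congr rfl fun j hj => by
      rw [Function.update_of_ne (Finset.ne_of_mem_erase hj)]
  rw [marginalCost, variablesCost, h'.variablesCostOn_eq hβ, h'.variablesCostOn_eq hβ,
    ← Finset.add_sum_erase _ _ (Finset.mem_univ i), ← Finset.mul_prod_erase _ _ (Finset.mem_univ i),
    hprod, Function.update_self, Primes.avoid]
  field_simp
  ring

/-- The excess of the marginal cost at `hi i` over the one at `lo i`. The first term in the bracket
vanishes for `β = 1`, where the costs `h p (p + b) / t + h t` at the two cycle times agree; the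
second vanishes if all other variable commodities `j` are ordered at `β * hi j`. -/
theorem Selects.marginalCost_sub (h : Selects S β v) (hβ : 0 < β) (φ : ThreeCNF n m)
    (i : Fin n) :
    marginalCost φ i (β * P.hi i) S - marginalCost φ i (β * P.lo i) S =
      P.gap i * (P.holdingCost φ (.variable i) * (β - 1 / β) +
        P.alphaC * ((∏ j ∈ Finset.univ.erase i, P.avoid j true) -
          ∏ j ∈ Finset.univ.erase i, P.avoid j (v j)) / (β * P.lo i * P.hi i)) := by
  have hlo : (P.lo i : ℝ) ≠ 0 := by exact_mod_cast (P.lo_prime i).ne_zero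
  have hhi : (P.hi i : ℝ) ≠ 0 := by exact_mod_cast (P.hi_prime i).ne_zero
  have e1 := h.marginalCost_eq hβ φ i true
  have e0 := h.marginalCost_eq hβ φ i false
  simp only [Primes.prime, if_true, Bool.false_eq_true, if_false, Primes.standaloneCost,
    Primes.orderingCost_variable, Primes.demand] at e1 e0
  rw [e1, e0, Primes.gap]
  generalize P.holdingCost φ (.variable i) = H
  field_simp
  ring

theorem prod_avoid_le (v : Fin n → Bool) (V : Finset (Fin n)) :
    ∏ j ∈ V, P.avoid j (v j) ≤ ∏ j ∈ V, P.avoid j true :=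
  Finset.prod_le_prod (fun j _ => (P.avoid_pos j _).le) fun j _ => P.avoid_le j _

theorem Selects.marginalCost_le (h : Selects S β v) (hβ : 1 ≤ β) (φ : ThreeCNF n m)
    (i : Fin n) :
    marginalCost φ i (β * P.lo i) S ≤ marginalCost φ i (β * P.hi i) S := by
  have hβ0 : 0 < β := by linarith
  have hβ' : 0 ≤ β - 1 / β := by
    have : 1 / β ≤ 1 := (div_le_one hβ0).2 hβ
    linarith
  rw [← sub_nonneg, h.marginalCost_sub hβ0]
  have h1 := (P.gap_pos i).le
  have h2 := (P.holdingCost_variable_pos φ i).le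
  have h3 := P.alphaC_pos.le
  have h4 := sub_nonneg.2 (prod_avoid_le (P := P) v (Finset.univ.erase i))
  positivity

theorem Selects.marginalCost_lt (h : Selects S β v) (hβ : 1 ≤ β) (φ : ThreeCNF n m) {i : Fin n}
    (hi : 1 < β ∨ ∃ j, j ≠ i ∧ v j = false) :
    marginalCost φ i (β * P.lo i) S < marginalCost φ i (β * P.hi i) S := by
  have hβ0 : 0 < β := by linarith
  have hβ' : 0 ≤ β - 1 / β := by
    have : 1 / β ≤ 1 := (div_le_one hβ0).2 hβ
    linarith
  have hlo : (0 : ℝ) < P.lo i := by exact_mod_cast (P.lo_prime i).pos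
  have hhi : (0 : ℝ) < P.hi i := by exact_mod_cast (P.hi_prime i).pos
  rw [← sub_pos, h.marginalCost_sub hβ0]
  have h1 := P.gap_pos i
  have h2 := P.holdingCost_variable_pos φ i
  have h3 := P.alphaC_pos
  have h4 := sub_nonneg.2 (prod_avoid_le (P := P) v (Finset.univ.erase i))
  refine mul_pos h1 ?_
  rcases hi with hi | ⟨j, hj, hvj⟩
  · refine add_pos_of_pos_of_nonneg (mul_pos h2 ?_) (by positivity)
    have : 1 / β < 1 := (div_lt_one hβ0).2 hi
    linarith
  · have h5 : ∏ k ∈ Finset.univ.erase i, P.avoid k (v k) <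
        ∏ k ∈ Finset.univ.erase i, P.avoid k true :=
      Finset.prod_lt_prod (fun k _ => P.avoid_pos k _) (fun k _ => P.avoid_le k _)
        ⟨j, by simp [hj], by rw [hvj]; exact P.avoid_false_lt j⟩
    have h6 := sub_pos.2 h5
    exact add_pos_of_nonneg_of_pos (by positivity) (by positivity)

theorem variablesCost_eq_of_selects {S' : P.Solution m} (h : Selects S β v) (h' : Selects S' β v)
    (hβ : 0 < β) (φ : ThreeCNF n m) : variablesCost φ S = variablesCost φ S' := by
  rw [variablesCost, variablesCost, h.variablesCostOn_eq hβ, h'.variablesCostOn_eq hβ]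

/-- `TC_Variables` of the solution obtained from `S` by ordering each variable commodity `i` at
`β` times the prime of `(i, w i)`. -/
noncomputable def selectedCost (φ : ThreeCNF n m) (S : P.Solution m) (β : ℝ) (w : Fin n → Bool) : ℝ :=
  variablesCost φ (setVariables S fun i => β * P.prime i (w i))

theorem Selects.selectedCost_update_false_le (h : Selects S β v) (hβ : 1 ≤ β) (φ : ThreeCNF n m)
    (w : Fin n → Bool) (i : Fin n) :
    selectedCost φ S β (Function.update w i false) ≤
      selectedCost φ S β (Function.update w i true) := by
  have hβ0 : 0 < β := by linarith
  have hw := h.setVariables w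
  -- The total cost is the marginal cost of `i` plus a cost that does not depend on its cycle time.
  have key : ∀ b, selectedCost φ S β (Function.update w i b) =
      marginalCost φ i (β * P.prime i b) (JRP.setVariables S fun i => β * P.prime i (w i)) +
        variablesCostOn φ (JRP.setVariables S fun i => β * P.prime i (w i))
          (Finset.univ.erase i) := fun b => by
    have hb := hw.setVariable i b
    rw [selectedCost, variablesCost_eq_of_selects (h.setVariables _) hb hβ0, marginalCost,
      hb.variablesCostOn_eq hβ0 φ (Finset.univ.erase i),
      hw.variablesCostOn_eq hβ0 φ (Finset.univ.erase i)]
    have hne : ∀ j ∈ Finset.univ.erase i, Function.update w i b j = w j := fun j hj =>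
      Function.update_of_ne (Finset.ne_of_mem_erase hj) _ _
    rw [Finset.prod_congr rfl fun j hj => by rw [hne j hj],
      Finset.sum_congr rfl fun j hj => by rw [hne j hj]]
    ring
  rw [key, key]
  exact add_le_add_left (hw.marginalCost_le hβ φ i) _

theorem Selects.monotone_selectedCost (h : Selects S β v) (hβ : 1 ≤ β) (φ : ThreeCNF n m) :
    Monotone (selectedCost φ S β) := by
  classical
  intro u w huw
  have key : ∀ s : Finset (Fin n), selectedCost φ S β u ≤ selectedCost φ S β (s.piecewise w u) := by
    intro s
    induction s using Finset.induction_on with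
    | empty => simp
    | insert i s hi ih =>
      rw [Finset.piecewise_insert]
      refine ih.trans ?_
      have hui : s.piecewise w u = Function.update (s.piecewise w u) i (u i) := by
        rw [← Finset.piecewise_eq_of_notMem s w u hi, Function.update_eq_self]
      have hle := huw i
      rcases hu : u i with _ | _ <;> rcases hw : w i with _ | _ <;> rw [hu] at hui
      · exact (congrArg _ hui).le
      · exact (congrArg _ hui).le.trans (h.selectedCost_update_false_le hβ φ _ i)
      · rw [hu, hw] at hle
        exact absurd (hle rfl) Bool.false_ne_true
      · exact (congrArg _ hui).le
  simpa using key Finset.univ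

end Selection

end JRP

theorem mainTheorem4 {n m : ℕ} (P : JRP.Primes n) (φ : JRP.ThreeCNF n m)
    (S : P.Solution m) (β : ℝ) (hS : JRP.HasSeed φ S β) :
    (∀ i : Fin n,
      JRP.marginalCost φ i (β * P.lo i) S ≤ JRP.marginalCost φ i (β * P.hi i) S) ∧
    (∀ i : Fin n,
      (1 < β ∨ ∃ j, j ≠ i ∧ S (.variable j) = β * P.lo j) →
        JRP.marginalCost φ i (β * P.lo i) S < JRP.marginalCost φ i (β * P.hi i) S) ∧
    JRP.variablesCost φ (JRP.setVariables S (fun i => β * P.lo i)) ≤ JRP.variablesCost φ S ∧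
    JRP.variablesCost φ S ≤ JRP.variablesCost φ (JRP.setVariables S (fun i => β * P.hi i)) := by
  obtain ⟨v, hv⟩ := hS.exists_selects
  have hβ := hS.one_le
  have hβ0 : 0 < β := by linarith
  have hcost : JRP.variablesCost φ S = JRP.selectedCost φ S β v :=
    JRP.variablesCost_eq_of_selects hv (hv.setVariables v) hβ0 φ
  refine ⟨hv.marginalCost_le hβ φ, fun i hi => hv.marginalCost_lt hβ φ ?_, ?_, ?_⟩
  · refine hi.imp_right ?_
    rintro ⟨j, hj, hSj⟩
    refine ⟨j, hj, ?_⟩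
    by_contra hne
    have hvj := hv.variable_eq j
    rw [Bool.eq_true_of_not_eq_false hne, hSj] at hvj
    have hlh : P.lo j = P.hi j := by exact_mod_cast mul_left_cancel₀ hβ0.ne' hvj
    exact (P.lo_lt_hi j).ne hlh
  · rw [hcost]
    exact hv.monotone_selectedCost hβ φ (a := fun _ => false) fun i => Bool.false_le _
  · rw [hcost]
    exact hv.monotone_selectedCost hβ φ (b := fun _ => true) fun i => Bool.le_true _
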